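/- Theorem (weak Dunford–Pettis theorem). Let $\mathbb K\in\{\mathbb R,\mathbb C\}$ be the scalar field. Let $(\Omega,\Sigma,\mu)$ be a complete measure space (every subset of a null set is measurable) that is strictly localizable, i.e. $\Omega$ has a partition $\mathcal P\subseteq\Sigma$ into sets of finite measure such that a set $E\subseteq\Omega$ belongs to $\Sigma$ whenever $E\cap A\in\Sigma$ for all $A\in\mathcal P$, and $\mu(E)=\sum_{A\in\mathcal P}\mu(E\cap A)$ for every $E\in\Sigma$. Let $F$ be a Banach space over $\mathbb K$ with dual space $F'$. Let $\mathcal L_{\sigma^*}(\Omega;F')$ be the space of all functions $k:\Omega\to F'$ such that $\omega\mapsto\langle k(\omega),v\rangle$ is measurable for every $v\in F$ and $$\|k\|_{\sigma^*}:=\sup_{v\in F,\ \|v\|\le1}\ \operatorname*{ess\,sup}_{\omega\in\Omega}|\langle k(\omega),v\rangle|<\infty ,$$ and let $L^\infty_{\sigma^*}(\Omega;F')$ be its quotient by the relation $k\sim l :\Leftrightarrow \|k-l\|_{\sigma^*}=0$, with the norm $\|[k]\|_\infty:=\|k\|_{\sigma^*}$. Then for all $k\in\mathcal L_{\sigma^*}(\Omega;F')$,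 $f\in L^1(\Omega,\mu;\mathbb K)$ and $v\in F$ the function $\omega\mapsto\langle k(\omega),v\rangle f(\omega)$ is integrable, and the formula $$\langle T_kf,v\rangle=\int_\Omega\langle k(\omega),v\rangle f(\omega)\,d\mu(\omega)\qquad(f\in L^1(\Omega),\ v\in F)$$ determines a well-defined map $[k]\mapsto T_k$ which is an isometric linear isomorphism from $L^\infty_{\sigma^*}(\Omega;F')$ onto the space $\mathscr L(L^1(\Omega),F')$ of bounded linear operators with the operator norm. -/

import Mathlib

open MeasureTheory
open scoped ENNReal

/-- A measure space is strictly localizable (decomposable) if it has a partition into measurable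
sets of finite measure such that a set is measurable as soon as its traces on all the
pieces are, and the measure of a measurable set is the sum of the measures of its traces. -/
def IsStrictlyLocalizable {Ω : Type*} [MeasurableSpace Ω] (μ : Measure Ω) : Prop :=
  ∃ P : Set (Set Ω),
    P.PairwiseDisjoint id ∧ ⋃₀ P = Set.univ ∧
    (∀ A ∈ P, MeasurableSet A ∧ μ A < ∞) ∧
    (∀ E : Set Ω, (∀ A ∈ P, MeasurableSet (E ∩ A)) → MeasurableSet E) ∧
    (∀ E : Set Ω, MeasurableSet E → μ E = ∑' A : P, μ (E ∩ A))

/-- `sup_{‖v‖ ≤ 1} ess sup_ω |⟨f(ω), v⟩|`, as an extended nonnegative real. -/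
noncomputable def sigmaStarSup {Ω : Type*} [MeasurableSpace Ω] (μ : Measure Ω)
    {𝕜 F : Type*} [RCLike 𝕜] [NormedAddCommGroup F] [NormedSpace 𝕜 F]
    (f : Ω → StrongDual 𝕜 F) : ℝ≥0∞ :=
  ⨆ v : Metric.closedBall (0 : F) 1, essSup (fun ω => ‖f ω (v : F)‖ₑ) μ

theorem sigmaStarSup_zero {Ω : Type*} [MeasurableSpace Ω] (μ : Measure Ω)
    {𝕜 F : Type*} [RCLike 𝕜] [NormedAddCommGroup F] [NormedSpace 𝕜 F] :
    sigmaStarSup μ (0 : Ω → StrongDual 𝕜 F) = 0 := by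
  simp only [sigmaStarSup, ENNReal.iSup_eq_zero]
  intro v
  exact eLpNormEssSup_zero (ε := 𝕜)

theorem sigmaStarSup_add_le {Ω : Type*} [MeasurableSpace Ω] (μ : Measure Ω)
    {𝕜 F : Type*} [RCLike 𝕜] [NormedAddCommGroup F] [NormedSpace 𝕜 F]
    (f g : Ω → StrongDual 𝕜 F) :
    sigmaStarSup μ (f + g) ≤ sigmaStarSup μ f + sigmaStarSup μ g := by
  refine iSup_le fun v => ?_
  have h : essSup (fun ω => ‖(f + g) ω (v : F)‖ₑ) μ ≤
      essSup (fun ω => ‖f ω (v : F)‖ₑ) μ + essSup (fun ω => ‖g ω (v : F)‖ₑ) μ :=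
    eLpNormEssSup_add_le (f := fun ω => f ω (v : F)) (g := fun ω => g ω (v : F))
  exact h.trans (add_le_add
    (le_iSup (fun v : Metric.closedBall (0 : F) 1 => essSup (fun ω => ‖f ω (v : F)‖ₑ) μ) v)
    (le_iSup (fun v : Metric.closedBall (0 : F) 1 => essSup (fun ω => ‖g ω (v : F)‖ₑ) μ) v))

theorem sigmaStarSup_smul {Ω : Type*} [MeasurableSpace Ω] (μ : Measure Ω)
    {𝕜 F : Type*} [RCLike 𝕜] [NormedAddCommGroup F] [NormedSpace 𝕜 F]
    (c : 𝕜) (f : Ω → StrongDual 𝕜 F) :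
    sigmaStarSup μ (c • f) = ‖c‖ₑ * sigmaStarSup μ f := by
  simp only [sigmaStarSup, ENNReal.mul_iSup]
  refine iSup_congr fun v => ?_
  exact eLpNormEssSup_const_smul c (fun ω => f ω (v : F))

/-- The `σ(F', F)`-measurable, `σ(F', F)`-bounded functions `Ω → F'`, as a subspace of all
functions. -/
def sigmaStarSubmodule (𝕜 F : Type*) [RCLike 𝕜] [NormedAddCommGroup F] [NormedSpace 𝕜 F]
    {Ω : Type*} [MeasurableSpace Ω] (μ : Measure Ω) : Submodule 𝕜 (Ω → StrongDual 𝕜 F) where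
  carrier := {f | (∀ v : F, Measurable fun ω => f ω v) ∧ sigmaStarSup μ f < ∞}
  zero_mem' := ⟨fun _ => measurable_const, by simp [sigmaStarSup_zero]⟩
  add_mem' := fun {f g} hf hg => ⟨fun v => (hf.1 v).add (hg.1 v),
    (sigmaStarSup_add_le μ f g).trans_lt (ENNReal.add_lt_top.2 ⟨hf.2, hg.2⟩)⟩
  smul_mem' := fun c f hf => ⟨fun v => (hf.1 v).const_smul c, by
    rw [sigmaStarSup_smul]; exact ENNReal.mul_lt_top enorm_lt_top hf.2⟩

/-- The space of `σ(F', F)`-measurable, `σ(F', F)`-bounded functions `Ω → F'`, before passing to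
equivalence classes. It is a type of its own so that it does not inherit the topology of pointwise
convergence. -/
def PreLinftySigmaStar (𝕜 F : Type*) [RCLike 𝕜] [NormedAddCommGroup F] [NormedSpace 𝕜 F]
    {Ω : Type*} [MeasurableSpace Ω] (μ : Measure Ω) : Type _ :=
  sigmaStarSubmodule 𝕜 F μ

namespace PreLinftySigmaStar

instance (𝕜 F : Type*) [RCLike 𝕜] [NormedAddCommGroup F] [NormedSpace 𝕜 F]
    {Ω : Type*} [MeasurableSpace Ω] (μ : Measure Ω) :
    AddCommGroup (PreLinftySigmaStar 𝕜 F μ) :=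
  inferInstanceAs (AddCommGroup (sigmaStarSubmodule 𝕜 F μ))

instance (𝕜 F : Type*) [RCLike 𝕜] [NormedAddCommGroup F] [NormedSpace 𝕜 F]
    {Ω : Type*} [MeasurableSpace Ω] (μ : Measure Ω) :
    Module 𝕜 (PreLinftySigmaStar 𝕜 F μ) :=
  inferInstanceAs (Module 𝕜 (sigmaStarSubmodule 𝕜 F μ))

instance (𝕜 F : Type*) [RCLike 𝕜] [NormedAddCommGroup F] [NormedSpace 𝕜 F]
    {Ω : Type*} [MeasurableSpace Ω] (μ : Measure Ω) :
    CoeFun (PreLinftySigmaStar 𝕜 F μ) (fun _ => Ω → StrongDual 𝕜 F) :=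
  ⟨Subtype.val⟩

/-- The seminorm `‖f‖ = sup_{‖v‖ ≤ 1} ess sup_ω |⟨f(ω), v⟩|`. -/
noncomputable instance (𝕜 F : Type*) [RCLike 𝕜] [NormedAddCommGroup F] [NormedSpace 𝕜 F]
    {Ω : Type*} [MeasurableSpace Ω] (μ : Measure Ω) :
    SeminormedAddCommGroup (PreLinftySigmaStar 𝕜 F μ) :=
  AddGroupSeminorm.toSeminormedAddCommGroup
    { toFun := fun f => (sigmaStarSup μ f).toReal
      map_zero' := by
        change (sigmaStarSup μ (0 : Ω → StrongDual 𝕜 F)).toReal = 0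
        simp [sigmaStarSup_zero]
      add_le' := fun f g => by
        change (sigmaStarSup μ ((f : Ω → StrongDual 𝕜 F) + (g : Ω → StrongDual 𝕜 F))).toReal ≤ _
        rw [← ENNReal.toReal_add f.2.2.ne g.2.2.ne]
        exact ENNReal.toReal_mono (ENNReal.add_ne_top.2 ⟨f.2.2.ne, g.2.2.ne⟩)
          (sigmaStarSup_add_le μ _ _)
      neg' := fun f => by
        change (sigmaStarSup μ (-(f : Ω → StrongDual 𝕜 F))).toReal = _
        rw [← neg_one_smul 𝕜 (f : Ω → StrongDual 𝕜 F), sigmaStarSup_smul]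
        simp }

theorem norm_def {𝕜 F : Type*} [RCLike 𝕜] [NormedAddCommGroup F] [NormedSpace 𝕜 F]
    {Ω : Type*} [MeasurableSpace Ω] {μ : Measure Ω} (f : PreLinftySigmaStar 𝕜 F μ) :
    ‖f‖ = (sigmaStarSup μ f).toReal := rfl

noncomputable instance (𝕜 F : Type*) [RCLike 𝕜] [NormedAddCommGroup F] [NormedSpace 𝕜 F]
    {Ω : Type*} [MeasurableSpace Ω] (μ : Measure Ω) :
    NormedSpace 𝕜 (PreLinftySigmaStar 𝕜 F μ) where
  norm_smul_le := fun c f => by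
    change (sigmaStarSup μ (c • (f : Ω → StrongDual 𝕜 F))).toReal ≤ _
    rw [sigmaStarSup_smul, ENNReal.toReal_mul, norm_def]
    simp

end PreLinftySigmaStar

/-- `L^∞_{σ*}(Ω; F')`: the quotient of the space of `σ(F', F)`-measurable, `σ(F', F)`-bounded
functions by the relation `‖f - g‖ = 0`, with the norm `‖[f]‖ = ‖f‖`. (The separation quotient of
a seminormed space identifies exactly the points at distance zero.) -/
abbrev LinftySigmaStar (𝕜 F : Type*) [RCLike 𝕜] [NormedAddCommGroup F] [NormedSpace 𝕜 F]
    {Ω : Type*} [MeasurableSpace Ω] (μ : Measure Ω) : Type _ :=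
  SeparationQuotient (PreLinftySigmaStar 𝕜 F μ)

/-! The bound `‖T_k‖ ≤ ‖k‖` is immediate. Conversely, testing `T_k` on indicators of sets `E` inside
a piece bounds the averages of `⟨k, v⟩` over `E` by `‖T_k‖`, hence `⟨k, v⟩` a.e.
(`ae_restrict_norm_le_of_forall_setIntegral`).

For surjectivity, fix a piece `A`. For each `v`, the functional `f ↦ ⟨T f, v⟩` has a bounded density
`g v` on `A` (`exists_bounded_density`, from the Riesz theorem in `L²`). The difficulty is that `v ↦
g v` is linear only a.e., with an exceptional null set depending on the vectors. A lifting cures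
this (`exists_lifting_filter`): every point `ω` receives a proper filter that ignores null sets and
that, for each measurable `E`, contains `E` at almost every `ω ∈ E`. Limits of `g v` along an
ultrafilter finer than the filter at `ω` are linear in `v` at every `ω` and agree with `g v` a.e.
(`exists_local_density`).

Strict localizability and completeness then allow gluing the local densities, and
`eq_zero_of_forall_indicatorConstLp` shows that the glued function represents `T`. -/

open Filter Topology

/-! ### Liftings of finite measures, by Zorn's lemma on partial liftings. -/

/-- A lifting of a sub-`σ`-algebra, encoded by filters: the set of points `ω` with `E ∈ N ω` is the
lifted representative of the class of `E`. -/
structure PartialLifting {Ω : Type*} [m : MeasurableSpace Ω] (μ : Measure Ω) where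
  σ : MeasurableSpace Ω
  le : σ ≤ m
  N : Ω → Filter Ω
  neBot : ∀ ω, (N ω).NeBot
  le_ae : ∀ ω, N ω ≤ ae μ
  dense : ∀ E, MeasurableSet[σ] E → ∀ᵐ ω ∂μ, ω ∈ E → E ∈ N ω
  gen : ∀ ω, ∀ S ∈ N ω, ∃ E, MeasurableSet[σ] E ∧ E ∈ N ω ∧ E ≤ᵐ[μ] S

namespace PartialLifting

variable {Ω : Type*} [m : MeasurableSpace Ω] {μ : Measure Ω}

instance : Preorder (PartialLifting μ) where
  le a b := a.σ ≤ b.σ ∧ ∀ ω, b.N ω ≤ a.N ω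
  le_refl a := ⟨le_rfl, fun _ => le_rfl⟩
  le_trans a b c h h' := ⟨h.1.trans h'.1, fun ω => (h'.2 ω).trans (h.2 ω)⟩

theorem mem_of_ae_le (p : PartialLifting μ) {ω : Ω} {S T : Set Ω} (hS : S ∈ p.N ω)
    (h : S ≤ᵐ[μ] T) : T ∈ p.N ω := by
  filter_upwards [hS, p.le_ae ω h] with x hx hxT using hxT hx

/-- The lifting of the trivial `σ`-algebra. -/
def trivial [NeZero μ] : PartialLifting μ where
  σ := ⊥
  le := bot_le
  N _ := ae μ
  neBot _ := inferInstance
  le_ae _ := le_rfl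
  dense E hE := by
    rcases MeasurableSpace.measurableSet_bot_iff.1 hE with rfl | rfl <;> simp
  gen ω S hS := ⟨Set.univ, MeasurableSet.univ, univ_mem, by
    filter_upwards [hS] with x hx _ using hx⟩

/-- The essentially largest set of a sub-`σ`-algebra that is almost disjoint from `E`. -/
theorem exists_max_disjoint {Ω : Type*} {σ m : MeasurableSpace Ω} {μ : Measure Ω}
    [IsFiniteMeasure μ] (hσ : σ ≤ m) {E : Set Ω} (hE : MeasurableSet E) :
    ∃ H, MeasurableSet[σ] H ∧ H ≤ᵐ[μ] Eᶜ ∧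
      ∀ A, MeasurableSet[σ] A → A ≤ᵐ[μ] Eᶜ → A ≤ᵐ[μ] H := by
  -- The set `{h ≤ 0}` is almost disjoint from `E` by integrating `h` over it, and it is maximal
  -- because `h` vanishes a.e. on any `A` in `σ` almost disjoint from `E`.
  set h : Ω → ℝ := μ[E.indicator (fun _ => (1 : ℝ)) | σ] with hh
  have hint : Integrable (E.indicator fun _ => (1 : ℝ)) μ := (integrable_const 1).indicator hE
  have hsm : StronglyMeasurable[σ] h := stronglyMeasurable_condExp
  have hH : MeasurableSet[σ] {x | h x ≤ 0} :=
    hsm.measurable measurableSet_Iic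
  have key : ∀ A, MeasurableSet[σ] A →
      μ[A.indicator (E.indicator fun _ => (1 : ℝ)) | σ] =ᵐ[μ] A.indicator h := fun A hA =>
    condExp_indicator hint hA
  refine ⟨{x | h x ≤ 0}, hH, ?_, fun A hA hAE => ?_⟩
  · have h1 : ∫ x in {x | h x ≤ 0}, h x ∂μ ≤ 0 := setIntegral_nonpos (hσ _ hH) fun x hx => hx
    rw [hh, setIntegral_condExp hσ hint hH, setIntegral_indicator hE] at h1
    simp only [setIntegral_const, smul_eq_mul, mul_one] at h1
    have h2 : μ ({x | h x ≤ 0} ∩ E) = 0 :=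
      (measureReal_eq_zero_iff).1 (le_antisymm h1 measureReal_nonneg)
    filter_upwards [measure_eq_zero_iff_ae_notMem.1 h2] with x hx hx1 hx2 using hx ⟨hx1, hx2⟩
  · have h0 : A.indicator (E.indicator fun _ => (1 : ℝ)) =ᵐ[μ] 0 := by
      filter_upwards [hAE] with x hx
      by_cases hxA : x ∈ A
      · have : x ∉ E := hx hxA
        simp [this]
      · simp [hxA]
    have h1 := (condExp_congr_ae h0 (m := σ)).symm.trans (key A hA)
    rw [condExp_zero] at h1
    filter_upwards [h1] with x hx hxA
    have : h x = 0 := by simpa [Set.indicator_of_mem (show x ∈ A from hxA)] using hx.symm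
    exact this.le

/-- If `Eᶜ ∈ p.N ω`, then `gen` puts the maximal set `H` almost disjoint from `E` into the filter,
whereas by `dense` almost every point of `E` has `Hᶜ` in its filter. -/
theorem ae_compl_notMem [IsFiniteMeasure μ] (p : PartialLifting μ) {E : Set Ω}
    (hE : MeasurableSet E) : ∀ᵐ ω ∂μ, ω ∈ E → Eᶜ ∉ p.N ω := by
  obtain ⟨H, hH, hHE, hmax⟩ := exists_max_disjoint (μ := μ) p.le hE
  filter_upwards [p.dense Hᶜ hH.compl, hHE] with ω h1 h2 hωE hmem
  obtain ⟨A, hA, hAN, hAE⟩ := p.gen ω _ hmem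
  have hHN := p.mem_of_ae_le hAN (hmax A hA hAE)
  have hHc : Hᶜ ∈ p.N ω := h1 fun hωH => h2 hωH hωE
  have := p.neBot ω
  exact (p.N ω).empty_notMem (by simpa using inter_mem hHN hHc)

/-- The `σ`-algebra generated by `σ` and `E`. -/
@[reducible] def adjoinSet (σ : MeasurableSpace Ω) (E : Set Ω) : MeasurableSpace Ω where
  MeasurableSet' C := ∃ A B, MeasurableSet[σ] A ∧ MeasurableSet[σ] B ∧ C = A ∩ E ∪ B \ E
  measurableSet_empty := ⟨∅, ∅, MeasurableSet.empty, MeasurableSet.empty, by simp⟩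
  measurableSet_compl := by
    rintro _ ⟨A, B, hA, hB, rfl⟩
    refine ⟨Aᶜ, Bᶜ, hA.compl, hB.compl, ?_⟩
    ext x
    by_cases hx : x ∈ E <;> simp [hx]
  measurableSet_iUnion f hf := by
    choose A B hA hB h using hf
    refine ⟨⋃ i, A i, ⋃ i, B i, MeasurableSet.iUnion hA, MeasurableSet.iUnion hB, ?_⟩
    ext x
    by_cases hx : x ∈ E <;> simp [hx, h]

open Classical in
theorem exists_extend_set [IsFiniteMeasure μ] (p : PartialLifting μ) {E : Set Ω}
    (hE : MeasurableSet E) : ∃ q : PartialLifting μ, p ≤ q ∧ MeasurableSet[q.σ] E := by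
  -- A modification of `E` on a null set, chosen so that at every point the filter stays proper
  -- after adding `E` (on `G`) or `Eᶜ` (off `G`).
  set G : Set Ω := {ω | Eᶜ ∉ p.N ω ∧ (ω ∈ E ∨ E ∈ p.N ω)} with hG
  have hGE : ∀ᵐ ω ∂μ, ω ∈ G ↔ ω ∈ E := by
    filter_upwards [p.ae_compl_notMem hE, p.ae_compl_notMem hE.compl] with ω h1 h2
    rw [compl_compl] at h2
    by_cases hω : ω ∈ E
    · simp [hG, hω, h1 hω]
    · simp [hG, hω, h2 hω]
  let F : Ω → Set Ω := fun ω => if ω ∈ G then E else Eᶜ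
  have hF : ∀ ω, (F ω)ᶜ ∉ p.N ω := fun ω => by
    by_cases hω : ω ∈ G
    · simpa [F, hω] using hω.1
    · simp only [F, hω, if_false, compl_compl]
      intro hEN
      have := p.neBot ω
      refine hω ⟨fun h => (p.N ω).empty_notMem ?_, Or.inr hEN⟩
      simpa using inter_mem hEN h
  have hsub : p.σ ≤ adjoinSet p.σ E := fun A hA => ⟨A, A, hA, hA, by simp⟩
  have hEσ : MeasurableSet[adjoinSet p.σ E] E :=
    ⟨Set.univ, ∅, @MeasurableSet.univ _ p.σ, @MeasurableSet.empty _ p.σ, by simp⟩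
  have hFσ : ∀ ω, MeasurableSet[adjoinSet p.σ E] (F ω) := fun ω => by
    by_cases hω : ω ∈ G
    · simpa [F, hω] using hEσ
    · simpa [F, hω] using hEσ.compl
  refine ⟨⟨adjoinSet p.σ E, ?_, fun ω => p.N ω ⊓ 𝓟 (F ω), fun ω => ?_,
    fun ω => inf_le_left.trans (p.le_ae ω), ?_, fun ω S hS => ?_⟩,
    ⟨hsub, fun ω => inf_le_left⟩, hEσ⟩
  · rintro _ ⟨A, B, hA, hB, rfl⟩
    exact ((p.le _ hA).inter hE).union ((p.le _ hB).diff hE)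
  · rw [neBot_iff, Ne, ← disjoint_iff, disjoint_principal_right]
    exact hF ω
  · rintro _ ⟨A, B, hA, hB, rfl⟩
    filter_upwards [p.dense A hA, p.dense B hB, hGE] with ω h1 h2 h3 hω
    rw [mem_inf_principal]
    rcases hω with ⟨hωA, hωE⟩ | ⟨hωB, hωE⟩
    · filter_upwards [h1 hωA] with x hx hxF
      simp only [F, h3.2 hωE, if_true] at hxF
      exact Or.inl ⟨hx, hxF⟩
    · filter_upwards [h2 hωB] with x hx hxF
      simp only [F, mt h3.1 hωE, if_false] at hxF
      exact Or.inr ⟨hx, hxF⟩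
  · rw [mem_inf_principal] at hS
    obtain ⟨A, hA, hAN, hAS⟩ := p.gen ω _ hS
    refine ⟨A ∩ F ω, (hsub _ hA).inter (hFσ ω),
      inter_mem_inf hAN (mem_principal_self _), ?_⟩
    filter_upwards [hAS] with x hx hxA using hx hxA.1 hxA.2

/-- The conditional probability of `E` given the `σ`-algebra of `p`. -/
noncomputable def condProb (p : PartialLifting μ) (E : Set Ω) : Ω → ℝ :=
  μ[E.indicator (fun _ => (1 : ℝ)) | p.σ]

theorem measurableSet_lt_condProb (p : PartialLifting μ) (E : Set Ω) (r : ℝ) :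
    MeasurableSet[p.σ] {x | r < p.condProb E x} :=
  (stronglyMeasurable_condExp (m := p.σ)).measurable measurableSet_Ioi

theorem condProb_of_measurable [IsFiniteMeasure μ] (p : PartialLifting μ) {E : Set Ω}
    (hE : MeasurableSet[p.σ] E) : p.condProb E = E.indicator fun _ => 1 :=
  condExp_of_stronglyMeasurable p.le (stronglyMeasurable_const.indicator hE)
    ((integrable_const 1).indicator (p.le _ hE))

/-- Conditional form of `1_E + 1_E' ≤ 1 + 1_(E ∩ E')`; it makes `limitFilter` closed under
intersections. -/
theorem condProb_inter [IsFiniteMeasure μ] (p : PartialLifting μ) {E E' : Set Ω}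
    (hE : MeasurableSet E) (hE' : MeasurableSet E') :
    ∀ᵐ x ∂μ, p.condProb E x + p.condProb E' x ≤ 1 + p.condProb (E ∩ E') x := by
  have hi : ∀ {S : Set Ω}, MeasurableSet S → Integrable (S.indicator fun _ => (1 : ℝ)) μ :=
    fun hS => (integrable_const 1).indicator hS
  have h1 := condExp_add (hi hE) (hi hE') p.σ
  have h2 := condExp_add (integrable_const (1 : ℝ)) (hi (hE.inter hE')) p.σ
  rw [condExp_const p.le] at h2
  have h3 : μ[(E.indicator fun _ => (1 : ℝ)) + E'.indicator fun _ => (1 : ℝ) | p.σ] ≤ᵐ[μ]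
      μ[(fun _ => (1 : ℝ)) + (E ∩ E').indicator fun _ => (1 : ℝ) | p.σ] := by
    refine condExp_mono ((hi hE).add (hi hE'))
      ((integrable_const (1 : ℝ)).add (hi (hE.inter hE'))) (ae_of_all _ fun x => ?_)
    by_cases hx : x ∈ E <;> by_cases hx' : x ∈ E' <;> simp [hx, hx']
  filter_upwards [h1, h2, h3] with x h1 h2 h3
  rw [h1, h2] at h3
  exact h3

/-- The filter defined by an increasing sequence of partial liftings. -/
noncomputable def limitFilter [IsFiniteMeasure μ] (p : ℕ → PartialLifting μ) (ω : Ω) :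
    Filter Ω where
  sets := {S | ∃ E, MeasurableSet[⨆ n, (p n).σ] E ∧ E ≤ᵐ[μ] S ∧
    ∀ ε > 0, ∀ᶠ n in atTop, {x | 1 - ε < (p n).condProb E x} ∈ (p n).N ω}
  univ_sets := ⟨Set.univ, MeasurableSet.univ, Filter.EventuallyLE.refl _ _, fun ε hε => by
    simp [condProb_of_measurable _ MeasurableSet.univ, hε]⟩
  sets_of_superset := by
    rintro S T ⟨E, hE, hES, h⟩ hST
    exact ⟨E, hE, hES.trans (ae_of_all _ hST), h⟩
  inter_sets := by
    rintro S T ⟨E, hE, hES, h⟩ ⟨E', hE', hES', h'⟩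
    have hle : ⨆ n, (p n).σ ≤ m := iSup_le fun n => (p n).le
    refine ⟨E ∩ E', hE.inter hE', ?_, fun ε hε => ?_⟩
    · filter_upwards [hES, hES'] with x hx hx' hxE using ⟨hx hxE.1, hx' hxE.2⟩
    · filter_upwards [h (ε / 2) (by positivity), h' (ε / 2) (by positivity)] with n hn hn'
      refine (p n).mem_of_ae_le (inter_mem hn hn') ?_
      filter_upwards [(p n).condProb_inter (hle _ hE) (hle _ hE')] with x hx hxE
      have h1 : 1 - ε / 2 < (p n).condProb E x := hxE.1
      have h2 : 1 - ε / 2 < (p n).condProb E' x := hxE.2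
      change 1 - ε < (p n).condProb (E ∩ E') x
      linarith

theorem mem_limitFilter [IsFiniteMeasure μ] {p : ℕ → PartialLifting μ} {ω : Ω} {S : Set Ω} :
    S ∈ limitFilter p ω ↔ ∃ E, MeasurableSet[⨆ n, (p n).σ] E ∧ E ≤ᵐ[μ] S ∧
      ∀ ε > 0, ∀ᶠ n in atTop, {x | 1 - ε < (p n).condProb E x} ∈ (p n).N ω := Iff.rfl

/-- The union of countably many `σ`-algebras need not be a `σ`-algebra, so sets of the supremum are
lifted through their conditional probabilities, which converge by Lévy's upward theorem. -/
theorem exists_ge_seq [IsFiniteMeasure μ] (p : ℕ → PartialLifting μ) (hp : Monotone p) :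
    ∃ q, ∀ n, p n ≤ q := by
  have hle : ⨆ n, (p n).σ ≤ m := iSup_le fun n => (p n).le
  refine ⟨⟨⨆ n, (p n).σ, hle, limitFilter p, fun ω => ?_, fun ω S hS => ?_, fun E hE => ?_,
    fun ω S hS => ?_⟩, fun n => ⟨le_iSup (fun n => (p n).σ) n, fun ω S hS => ?_⟩⟩
  · refine ⟨fun hbot => ?_⟩
    -- A null set has conditional probability zero a.e., so it never exceeds `1 - 1`; this
    -- contradicts properness of the filters `(p n).N ω`.
    obtain ⟨E, -, hE0, h⟩ := mem_limitFilter.1 (hbot ▸ mem_bot : ∅ ∈ limitFilter p ω)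
    obtain ⟨n, hn⟩ := (h 1 one_pos).exists
    have h0 : E.indicator (fun _ => (1 : ℝ)) =ᵐ[μ] 0 := by
      filter_upwards [hE0] with x hx
      have : x ∉ E := fun h => hx h
      simp [this]
    have h1 := condExp_congr_ae h0 (m := (p n).σ)
    rw [condExp_zero] at h1
    have := (p n).neBot ω
    refine ((p n).N ω).empty_notMem ((p n).mem_of_ae_le hn ?_)
    filter_upwards [h1] with x hx hxE
    have h2 : 1 - 1 < (p n).condProb E x := hxE
    have h3 : (p n).condProb E x = 0 := hx
    linarith
  · exact ⟨Set.univ, MeasurableSet.univ, by filter_upwards [hS] with x hx _ using hx,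
      fun ε hε => by simp [condProb_of_measurable _ MeasurableSet.univ, hε]⟩
  · let ℱ : Filtration ℕ m := ⟨fun n => (p n).σ, fun i j h => (hp h).1, fun n => (p n).le⟩
    have hlevy := tendsto_ae_condExp (μ := μ) (ℱ := ℱ) (E.indicator fun _ => (1 : ℝ))
    have hE1 : μ[E.indicator (fun _ => (1 : ℝ)) | ⨆ n, ℱ n] = E.indicator fun _ => (1 : ℝ) :=
      condExp_of_stronglyMeasurable hle (stronglyMeasurable_const.indicator hE)
        ((integrable_const 1).indicator (hle _ hE))
    -- Only the levels `1 - 1 / (k + 1)` are used, so that countably many null sets suffice.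
    have hden : ∀ᵐ ω ∂μ, ∀ n k : ℕ, 1 - 1 / ((k : ℝ) + 1) < (p n).condProb E ω →
        {x | 1 - 1 / ((k : ℝ) + 1) < (p n).condProb E x} ∈ (p n).N ω :=
      ae_all_iff.2 fun n => ae_all_iff.2 fun k =>
        (p n).dense _ ((p n).measurableSet_lt_condProb E _)
    filter_upwards [hlevy, hden] with ω h1 h2 hωE
    rw [hE1, Set.indicator_of_mem hωE] at h1
    refine mem_limitFilter.2 ⟨E, hE, Filter.EventuallyLE.refl _ _, fun ε hε => ?_⟩
    obtain ⟨k, hk⟩ := exists_nat_one_div_lt hε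
    have hk0 : (0 : ℝ) < 1 / ((k : ℝ) + 1) := by positivity
    filter_upwards [h1.eventually_const_lt (show 1 - 1 / ((k : ℝ) + 1) < 1 by linarith)] with n hn
    filter_upwards [h2 n k hn] with x hx
    have : 1 - 1 / ((k : ℝ) + 1) < (p n).condProb E x := hx
    change 1 - ε < (p n).condProb E x
    linarith
  · obtain ⟨E, hE, hES, h⟩ := mem_limitFilter.1 hS
    exact ⟨E, hE, mem_limitFilter.2 ⟨E, hE, Filter.EventuallyLE.refl _ _, h⟩, hES⟩
  · obtain ⟨E, hE, hEN, hES⟩ := (p n).gen ω S hS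
    refine mem_limitFilter.2 ⟨E, le_iSup (fun n => (p n).σ) n _ hE, hES, fun ε hε => ?_⟩
    filter_upwards [eventually_ge_atTop n] with k hk
    rw [condProb_of_measurable _ ((hp hk).1 _ hE)]
    filter_upwards [(hp hk).2 ω hEN] with x hx
    simp [Set.indicator_of_mem hx, hε]

/-- With a countable cofinal family the chain reduces to a sequence. Otherwise every countable
subfamily is bounded inside the chain, so the union of the `σ`-algebras is already a `σ`-algebra and
the infimum of the filters works. -/
theorem bddAbove_of_isChain [IsFiniteMeasure μ] {C : Set (PartialLifting μ)}
    (hC : IsChain (· ≤ ·) C) (hne : C.Nonempty) : BddAbove C := by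
  have htot : ∀ a ∈ C, ∀ b ∈ C, a ≤ b ∨ b ≤ a := fun a ha b hb => hC.total ha hb
  by_cases hcof : ∃ u : ℕ → PartialLifting μ, (∀ n, u n ∈ C) ∧ ∀ c ∈ C, ∃ n, c ≤ u n
  · obtain ⟨u, huC, hu⟩ := hcof
    have hdir : Directed (· ≤ ·) u := fun i j => by
      rcases htot _ (huC i) _ (huC j) with h | h
      · exact ⟨j, h, le_rfl⟩
      · exact ⟨i, le_rfl, h⟩
    obtain ⟨q, hq⟩ := exists_ge_seq _ hdir.sequence_mono
    refine ⟨q, fun c hc => ?_⟩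
    obtain ⟨n, hn⟩ := hu c hc
    exact hn.trans ((hdir.le_sequence n).trans (hq _))
  · push Not at hcof
    have hsup : ∀ u : ℕ → PartialLifting μ, (∀ n, u n ∈ C) → ∃ c ∈ C, ∀ n, u n ≤ c := by
      intro u hu
      obtain ⟨c, hc, h⟩ := hcof u hu
      exact ⟨c, hc, fun n => (htot _ (hu n) _ hc).resolve_right (h n)⟩
    have : Nonempty C := hne.to_subtype
    have hdir : ∀ ω, Directed (· ≥ ·) fun c : C => c.1.N ω := fun ω i j => by
      rcases htot _ i.2 _ j.2 with h | h
      · exact ⟨j, h.2 ω, le_rfl⟩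
      · exact ⟨i, le_rfl, h.2 ω⟩
    refine ⟨⟨⟨fun E => ∃ c ∈ C, MeasurableSet[c.σ] E, ?_, ?_, ?_⟩, ?_,
      fun ω => ⨅ c : C, c.1.N ω, fun ω => ?_, fun ω => ?_, ?_, fun ω S hS => ?_⟩, fun c hc =>
        ⟨fun E hE => ⟨c, hc, hE⟩, fun ω => iInf_le (fun c : C => c.1.N ω) ⟨c, hc⟩⟩⟩
    · obtain ⟨c, hc⟩ := hne
      exact ⟨c, hc, @MeasurableSet.empty _ c.σ⟩
    · rintro E ⟨c, hc, hE⟩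
      exact ⟨c, hc, hE.compl⟩
    · intro f hf
      choose u huC hu using hf
      obtain ⟨c, hc, h⟩ := hsup u huC
      exact ⟨c, hc, MeasurableSet.iUnion fun n => (h n).1 _ (hu n)⟩
    · rintro E ⟨c, -, hE⟩
      exact c.le _ hE
    · have := fun c : C => c.1.neBot ω
      exact iInf_neBot_of_directed' (hdir ω) this
    · exact (iInf_le _ (Classical.arbitrary C)).trans ((Classical.arbitrary C).1.le_ae ω)
    · rintro E ⟨c, hc, hE⟩
      filter_upwards [c.dense E hE] with ω h hω
      exact mem_iInf_of_mem (⟨c, hc⟩ : C) (h hω)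
    · obtain ⟨c, hcS⟩ := (mem_iInf_of_directed (hdir ω) S).1 hS
      obtain ⟨E, hE, hEN, hES⟩ := c.1.gen ω S hcS
      exact ⟨E, ⟨c, c.2, hE⟩, mem_iInf_of_mem c hEN, hES⟩

end PartialLifting

/-- **Lifting theorem** for finite measures, in terms of filters. -/
theorem exists_lifting_filter {Ω : Type*} [MeasurableSpace Ω] (μ : Measure Ω) [IsFiniteMeasure μ]
    [NeZero μ] : ∃ N : Ω → Filter Ω, (∀ ω, (N ω).NeBot) ∧ (∀ ω, N ω ≤ ae μ) ∧
      ∀ E, MeasurableSet E → ∀ᵐ ω ∂μ, ω ∈ E → E ∈ N ω := by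
  have : Nonempty (PartialLifting μ) := ⟨PartialLifting.trivial⟩
  obtain ⟨p, hp⟩ := zorn_le_nonempty (α := PartialLifting μ)
    fun C hC hne => PartialLifting.bddAbove_of_isChain hC hne
  refine ⟨p.N, p.neBot, p.le_ae, fun E hE => p.dense E ?_⟩
  obtain ⟨q, hpq, hq⟩ := p.exists_extend_set hE
  exact (hp hpq).1 _ hq

/-- A countable base leaves only countably many preimages to lift. This is what identifies limits
along the lifting with the original function a.e. -/
theorem ae_tendsto_of_lifting_filter {Ω X : Type*} [MeasurableSpace Ω] {μ : Measure Ω}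
    [TopologicalSpace X] [SecondCountableTopology X] [MeasurableSpace X] [OpensMeasurableSpace X]
    {N : Ω → Filter Ω} (hN : ∀ E, MeasurableSet E → ∀ᵐ ω ∂μ, ω ∈ E → E ∈ N ω)
    {g : Ω → X} (hg : Measurable g) : ∀ᵐ ω ∂μ, Tendsto g (N ω) (𝓝 (g ω)) := by
  have hB := TopologicalSpace.isBasis_countableBasis X
  have h : ∀ᵐ ω ∂μ, ∀ B ∈ TopologicalSpace.countableBasis X, g ω ∈ B → g ⁻¹' B ∈ N ω :=
    (ae_ball_iff (TopologicalSpace.countable_countableBasis X)).2 fun B hBmem =>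
      hN _ (hg (hB.isOpen hBmem).measurableSet)
  filter_upwards [h] with ω hω
  refine (hB.nhds_hasBasis).tendsto_right_iff.2 ?_
  rintro B ⟨hBmem, hgB⟩
  exact hω B hBmem hgB

/-! ### Densities on a set of finite measure. -/

/-- The averages control `re (z * g)` a.e. for each `z`; a countable dense set of `z` gives one
common null set, and continuity gives all `z`, in particular the conjugate of `g ω`. -/
theorem ae_restrict_norm_le_of_forall_setIntegral {Ω 𝕜 : Type*} [RCLike 𝕜] [MeasurableSpace Ω]
    {μ : Measure Ω} {A : Set Ω} (hA : MeasurableSet A) (hμA : μ A ≠ ∞) {g : Ω → 𝕜}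
    (hg : IntegrableOn g A μ) {C : ℝ}
    (h : ∀ E, MeasurableSet E → E ⊆ A → ‖∫ ω in E, g ω ∂μ‖ ≤ C * μ.real E) :
    ∀ᵐ ω ∂μ.restrict A, ‖g ω‖ ≤ C := by
  obtain ⟨D, hDc, hD⟩ := TopologicalSpace.exists_countable_dense 𝕜
  have key : ∀ z : 𝕜, ∀ᵐ ω ∂μ.restrict A, RCLike.re (z * g ω) ≤ ‖z‖ * C := by
    intro z
    have hzg : IntegrableOn (fun ω => z * g ω) A μ := hg.const_mul z
    have hre : IntegrableOn (fun ω => RCLike.re (z * g ω)) A μ := hzg.re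
    have hc : IntegrableOn (fun _ : Ω => ‖z‖ * C) A μ := integrableOn_const hμA
    have h0 : 0 ≤ᵐ[μ.restrict A] fun ω => ‖z‖ * C - RCLike.re (z * g ω) := by
      refine ae_nonneg_restrict_of_forall_setIntegral_nonneg_inter (hc.sub hre) ?_
      intro s hs _
      have hsub : s ∩ A ⊆ A := Set.inter_subset_right
      have hm : μ (s ∩ A) ≠ ∞ := measure_ne_top_of_subset hsub hμA
      rw [integral_sub (hc.mono_set hsub) (hre.mono_set hsub), setIntegral_const, smul_eq_mul,
        sub_nonneg, integral_re (hzg.mono_set hsub), integral_const_mul]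
      calc RCLike.re (z * ∫ ω in s ∩ A, g ω ∂μ) ≤ ‖z * ∫ ω in s ∩ A, g ω ∂μ‖ := RCLike.re_le_norm _
        _ = ‖z‖ * ‖∫ ω in s ∩ A, g ω ∂μ‖ := norm_mul _ _
        _ ≤ ‖z‖ * (C * μ.real (s ∩ A)) := by gcongr; exact h _ (hs.inter hA) hsub
        _ = μ.real (s ∩ A) * (‖z‖ * C) := by ring
    filter_upwards [h0] with ω hω using sub_nonneg.1 hω
  filter_upwards [(ae_ball_iff hDc).2 fun z _ => key z] with ω hω
  have hcl : IsClosed {z : 𝕜 | RCLike.re (z * g ω) ≤ ‖z‖ * C} :=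
    isClosed_le (by fun_prop) (by fun_prop)
  have hall : ∀ z : 𝕜, RCLike.re (z * g ω) ≤ ‖z‖ * C := fun z =>
    hcl.closure_subset_iff.2 (fun z hz => hω z hz) (hD z)
  have h1 := hall (starRingEnd 𝕜 (g ω))
  rw [RCLike.conj_mul, RCLike.norm_conj, ← RCLike.ofReal_pow, RCLike.ofReal_re, pow_two] at h1
  rcases (norm_nonneg (g ω)).eq_or_lt with h0 | h0
  -- Where `g` vanishes the claim is `0 ≤ C`, which any nonzero `z` yields.
  · obtain ⟨z, hz⟩ := NormedField.exists_one_lt_norm 𝕜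
    have h2 := hall z
    rw [norm_eq_zero.1 h0.symm, mul_zero, map_zero] at h2
    rw [← h0]
    exact nonneg_of_mul_nonneg_right h2 (one_pos.trans hz)
  · exact le_of_mul_le_mul_left h1 h0

theorem ae_restrict_eq_of_forall_setIntegral {Ω 𝕜 : Type*} [RCLike 𝕜] [MeasurableSpace Ω]
    {μ : Measure Ω} {A : Set Ω} (hA : MeasurableSet A) (hμA : μ A ≠ ∞) {g g' : Ω → 𝕜}
    (hg : IntegrableOn g A μ) (hg' : IntegrableOn g' A μ)
    (h : ∀ E, MeasurableSet E → E ⊆ A → ∫ ω in E, g ω ∂μ = ∫ ω in E, g' ω ∂μ) :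
    g =ᵐ[μ.restrict A] g' := by
  have h0 := ae_restrict_norm_le_of_forall_setIntegral hA hμA (hg.sub hg') (C := 0)
    fun E hE hEA => by
      simp only [Pi.sub_apply]
      rw [integral_sub (hg.mono_set hEA) (hg'.mono_set hEA), h E hE hEA]
      simp
  filter_upwards [h0] with ω hω using sub_eq_zero.1 (norm_le_zero_iff.1 hω)

theorem norm_apply_indicatorConstLp_le {Ω 𝕜 G : Type*} [RCLike 𝕜] [MeasurableSpace Ω]
    [SeminormedAddCommGroup G] [NormedSpace 𝕜 G]
    {μ : Measure Ω} (φ : Lp 𝕜 1 μ →L[𝕜] G) {E : Set Ω} (hE : MeasurableSet E) (hμE : μ E ≠ ∞) :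
    ‖φ (indicatorConstLp 1 hE hμE (1 : 𝕜))‖ ≤ ‖φ‖ * μ.real E := by
  refine (φ.le_opNorm _).trans ?_
  rw [norm_indicatorConstLp one_ne_zero ENNReal.one_ne_top]
  simp

/-- On a set of finite measure, a bounded functional on `L¹` is given by a bounded function. -/
theorem exists_bounded_density {Ω 𝕜 : Type*} [RCLike 𝕜] [MeasurableSpace Ω]
    {μ : Measure Ω} {A : Set Ω} (hA : MeasurableSet A) (hμA : μ A ≠ ∞) (φ : Lp 𝕜 1 μ →L[𝕜] 𝕜) :
    ∃ g : Ω → 𝕜, Measurable g ∧ (∀ ω, ‖g ω‖ ≤ ‖φ‖) ∧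
      ∀ (E : Set Ω) (hE : MeasurableSet E) (hμE : μ E ≠ ∞), E ⊆ A →
        φ (indicatorConstLp 1 hE hμE 1) = ∫ ω in E, g ω ∂μ := by
  let B := ContinuousLinearMap.mul 𝕜 𝕜
  -- As `A` has finite measure, multiplication by `1_A` maps `L²` into `L¹`, so `φ` becomes a
  -- functional on a Hilbert space.
  let ψ : Lp 𝕜 2 μ →L[𝕜] 𝕜 := φ ∘L (B.holderL μ 2 2 1 (indicatorConstLp 2 hA hμA 1))
  let u : Lp 𝕜 2 μ := (InnerProductSpace.toDual 𝕜 _).symm ψ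
  have hu : IntegrableOn (fun ω => starRingEnd 𝕜 (u ω)) A μ := by
    have := integrableOn_Lp_of_measure_ne_top u fact_one_le_two_ennreal.elim hμA
    exact (LinearIsometryEquiv.integrable_comp_iff RCLike.conjLIE).2 this
  have hφ : ∀ (E : Set Ω) (hE : MeasurableSet E) (hμE : μ E ≠ ∞), E ⊆ A →
      φ (indicatorConstLp 1 hE hμE 1) = ∫ ω in E, starRingEnd 𝕜 (u ω) ∂μ := by
    intro E hE hμE hEA
    have h1 : B.holderL μ 2 2 1 (indicatorConstLp 2 hA hμA 1) (indicatorConstLp 2 hE hμE 1) =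
        indicatorConstLp 1 hE hμE (1 : 𝕜) := by
      refine Lp.ext ?_
      have h2 := B.coeFn_holder (r := 1) (indicatorConstLp 2 hA hμA (1 : 𝕜))
        (indicatorConstLp 2 hE hμE (1 : 𝕜))
      filter_upwards [h2, indicatorConstLp_coeFn (p := 2) (hs := hA) (hμs := hμA) (c := (1 : 𝕜)),
        indicatorConstLp_coeFn (p := 2) (hs := hE) (hμs := hμE) (c := (1 : 𝕜)),
        indicatorConstLp_coeFn (p := 1) (hs := hE) (hμs := hμE) (c := (1 : 𝕜))]
        with ω h2 h3 h4 h5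
      refine h2.trans ?_
      rw [h3, h4, h5]
      by_cases hω : ω ∈ E
      · simp [B, hω, hEA hω]
      · simp [B, hω]
    have h2 : ψ (indicatorConstLp 2 hE hμE 1) = inner 𝕜 u (indicatorConstLp 2 hE hμE 1) :=
      (InnerProductSpace.toDual_symm_apply).symm
    rw [← h1]
    refine h2.trans ?_
    rw [← inner_conj_symm, L2.inner_indicatorConstLp_one, integral_conj]
  have hbound := ae_restrict_norm_le_of_forall_setIntegral hA hμA hu (C := ‖φ‖)
    fun E hE hEA => by
      have hμE : μ E ≠ ∞ := measure_ne_top_of_subset hEA hμA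
      rw [← hφ E hE hμE hEA]
      exact norm_apply_indicatorConstLp_le φ hE hμE
  have hmeas : AEMeasurable (fun ω => starRingEnd 𝕜 (u ω)) (μ.restrict A) := hu.aemeasurable
  let g₀ := hmeas.mk _
  have hg₀ : Measurable g₀ := hmeas.measurable_mk
  have hS : MeasurableSet {ω | ‖g₀ ω‖ ≤ ‖φ‖} := measurableSet_le hg₀.norm measurable_const
  -- Cutting off makes the bound hold everywhere; integrals over subsets of `A` are unchanged, since
  -- there the bound already holds a.e.
  refine ⟨{ω | ‖g₀ ω‖ ≤ ‖φ‖}.indicator g₀, hg₀.indicator hS, fun ω => ?_,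
    fun E hE hμE hEA => ?_⟩
  · by_cases hω : ω ∈ {ω | ‖g₀ ω‖ ≤ ‖φ‖}
    · rw [Set.indicator_of_mem hω]
      exact hω
    · simp [Set.indicator_of_notMem hω]
  · rw [hφ E hE hμE hEA]
    refine integral_congr_ae (ae_mono (Measure.restrict_mono hEA le_rfl) ?_)
    filter_upwards [hbound, hmeas.ae_eq_mk] with ω h1 h2
    have h3 : ω ∈ {ω | ‖g₀ ω‖ ≤ ‖φ‖} := by
      change ‖hmeas.mk _ ω‖ ≤ ‖φ‖
      rw [← h2]; exact h1
    rw [Set.indicator_of_mem h3]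
    exact h2

/-- On a set of finite measure, a bounded operator from `L¹` to a dual space is given by a bounded
weak-* measurable function. -/
theorem exists_local_density {Ω 𝕜 F : Type*} [RCLike 𝕜] [NormedAddCommGroup F] [NormedSpace 𝕜 F]
    [MeasurableSpace Ω] {μ : Measure Ω} {A : Set Ω} (hA : MeasurableSet A) (hμA : μ A ≠ ∞)
    (T : Lp 𝕜 1 μ →L[𝕜] StrongDual 𝕜 F) :
    ∃ k : Ω → StrongDual 𝕜 F, (∀ ω, ‖k ω‖ ≤ ‖T‖) ∧
      (∀ v, AEMeasurable (fun ω => k ω v) (μ.restrict A)) ∧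
      ∀ (E : Set Ω) (hE : MeasurableSet E) (hμE : μ E ≠ ∞), E ⊆ A → ∀ v,
        T (indicatorConstLp 1 hE hμE 1) v = ∫ ω in E, k ω v ∂μ := by
  have : IsFiniteMeasure (μ.restrict A) := isFiniteMeasure_restrict.2 hμA
  rcases eq_zero_or_neZero (μ.restrict A) with h0 | h0
  · refine ⟨0, fun ω => norm_zero.trans_le (norm_nonneg T), fun v => by simp [h0], fun E hE hμE hEA v => ?_⟩
    have hE0 : μ E = 0 := measure_mono_null hEA (Measure.restrict_eq_zero.1 h0)
    have : T (indicatorConstLp 1 hE hμE 1) = 0 := by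
      refine norm_le_zero_iff.1 ((norm_apply_indicatorConstLp_le T hE hμE).trans ?_)
      simp [Measure.real, hE0]
    simp [this]
  obtain ⟨N, hNne, hNae, hN⟩ := exists_lifting_filter (μ.restrict A)
  choose g hgm hgb hg using fun v => exists_bounded_density hA hμA (T.flip v)
  have hgb' : ∀ v ω, ‖g v ω‖ ≤ ‖T‖ * ‖v‖ := fun v ω =>
    (hgb v ω).trans ((T.flip.le_opNorm v).trans_eq (by rw [T.opNorm_flip]))
  have hgi : ∀ v, IntegrableOn (g v) A μ := fun v =>
    Integrable.of_bound (hgm v).aestronglyMeasurable (‖T‖ * ‖v‖) (ae_of_all _ (hgb' v))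
  have hadd : ∀ v w, g (v + w) =ᵐ[μ.restrict A] fun ω => g v ω + g w ω := fun v w => by
    refine ae_restrict_eq_of_forall_setIntegral hA hμA (hgi _) ((hgi v).add (hgi w))
      fun E hE hEA => ?_
    have hμE : μ E ≠ ∞ := measure_ne_top_of_subset hEA hμA
    rw [integral_add ((hgi v).mono_set hEA) ((hgi w).mono_set hEA), ← hg _ E hE hμE hEA,
      ← hg _ E hE hμE hEA, ← hg _ E hE hμE hEA]
    simp
  have hsmul : ∀ (c : 𝕜) v, g (c • v) =ᵐ[μ.restrict A] fun ω => c * g v ω := fun c v => by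
    refine ae_restrict_eq_of_forall_setIntegral hA hμA (hgi _) ((hgi v).const_mul c)
      fun E hE hEA => ?_
    have hμE : μ E ≠ ∞ := measure_ne_top_of_subset hEA hμA
    rw [integral_const_mul, ← hg _ E hE hμE hEA, ← hg _ E hE hμE hEA]
    simp
  -- The values of `g v` stay in a compact ball, so the ultrafilter provides a limit for every `v`
  -- at every `ω`.
  have hlim : ∀ ω v, ∃ x : 𝕜, ‖x‖ ≤ ‖T‖ * ‖v‖ ∧
      Tendsto (g v) (@Ultrafilter.of _ (N ω) (hNne ω)) (𝓝 x) := by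
    intro ω v
    have hK := isCompact_closedBall (0 : 𝕜) (‖T‖ * ‖v‖)
    obtain ⟨x, hx, hle⟩ := hK.ultrafilter_le_nhds
      ((@Ultrafilter.of _ (N ω) (hNne ω)).map (g v))
      (by
        rw [le_principal_iff]
        exact mem_map.2 (univ_mem' fun ω' => mem_closedBall_zero_iff.2 (hgb' v ω')))
    exact ⟨x, mem_closedBall_zero_iff.1 hx, hle⟩
  choose l hlb hl using hlim
  have hUae : ∀ ω, (@Ultrafilter.of _ (N ω) (hNne ω) : Filter Ω) ≤ ae (μ.restrict A) := fun ω =>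
    (@Ultrafilter.of_le _ (N ω) (hNne ω)).trans (hNae ω)
  -- Additivity and homogeneity of `g` fail only on null sets, which the ultrafilter ignores; hence
  -- the limits are linear with no exceptional `ω`.
  let k : Ω → StrongDual 𝕜 F := fun ω => LinearMap.mkContinuous
    { toFun := l ω
      map_add' := fun v w => tendsto_nhds_unique
        ((hl ω (v + w)).congr' ((hadd v w).filter_mono (hUae ω))) ((hl ω v).add (hl ω w))
      map_smul' := fun c v => tendsto_nhds_unique
        ((hl ω (c • v)).congr' ((hsmul c v).filter_mono (hUae ω))) ((hl ω v).const_mul c) }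
    ‖T‖ (hlb ω)
  have hkg : ∀ v, (fun ω => k ω v) =ᵐ[μ.restrict A] g v := fun v => by
    filter_upwards [ae_tendsto_of_lifting_filter hN (hgm v)] with ω hω
    exact tendsto_nhds_unique (hl ω v) (hω.mono_left (@Ultrafilter.of_le _ (N ω) (hNne ω)))
  refine ⟨k, fun ω => LinearMap.mkContinuous_norm_le _ (norm_nonneg T) _,
    fun v => ⟨g v, hgm v, hkg v⟩, fun E hE hμE hEA v => ?_⟩
  have h1 := hg v E hE hμE hEA
  rw [ContinuousLinearMap.flip_apply] at h1
  rw [h1]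
  exact integral_congr_ae
    (Filter.EventuallyEq.symm (ae_mono (Measure.restrict_mono hEA le_rfl) (hkg v)))

/-! ### Passing from the pieces to the whole space. -/

/-- Completeness makes the null traces measurable, so `Z` itself is measurable and its measure is a
sum of zeros. -/
theorem measure_eq_zero_of_forall_inter {Ω : Type*} [MeasurableSpace Ω] {μ : Measure Ω}
    [μ.IsComplete] {P : Set (Set Ω)}
    (hPm : ∀ E : Set Ω, (∀ A ∈ P, MeasurableSet (E ∩ A)) → MeasurableSet E)
    (hPs : ∀ E : Set Ω, MeasurableSet E → μ E = ∑' A : P, μ (E ∩ A))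
    {Z : Set Ω} (hZ : ∀ A ∈ P, μ (Z ∩ A) = 0) : μ Z = 0 := by
  rw [hPs Z (hPm Z fun A hA => measurableSet_of_null (hZ A hA))]
  simp [hZ]

theorem ae_of_forall_ae_restrict {Ω : Type*} [MeasurableSpace Ω] {μ : Measure Ω}
    [μ.IsComplete] {P : Set (Set Ω)} (hP : ∀ A ∈ P, MeasurableSet A ∧ μ A < ∞)
    (hPm : ∀ E : Set Ω, (∀ A ∈ P, MeasurableSet (E ∩ A)) → MeasurableSet E)
    (hPs : ∀ E : Set Ω, MeasurableSet E → μ E = ∑' A : P, μ (E ∩ A))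
    {p : Ω → Prop} (h : ∀ A ∈ P, ∀ᵐ ω ∂μ.restrict A, p ω) : ∀ᵐ ω ∂μ, p ω := by
  refine measure_eq_zero_of_forall_inter hPm hPs fun A hA => ?_
  have := h A hA
  rwa [ae_iff, Measure.restrict_apply' (hP A hA).1] at this

/-- A bounded functional on `L¹` that vanishes on the indicators of all subsets of the pieces of a
decomposition vanishes. -/
theorem eq_zero_of_forall_indicatorConstLp {Ω 𝕜 : Type*} [RCLike 𝕜] [MeasurableSpace Ω]
    {μ : Measure Ω} {P : Set (Set Ω)} (hP : ∀ A ∈ P, MeasurableSet A ∧ μ A < ∞)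
    (hPs : ∀ E : Set Ω, MeasurableSet E → μ E = ∑' A : P, μ (E ∩ A))
    (φ : Lp 𝕜 1 μ →L[𝕜] 𝕜)
    (h : ∀ A ∈ P, ∀ (E : Set Ω) (hE : MeasurableSet E) (hμE : μ E ≠ ∞), E ⊆ A →
      φ (indicatorConstLp 1 hE hμE 1) = 0) : φ = 0 := by
  have hU : ∀ t : Finset P, MeasurableSet (⋃ A ∈ t, (A : Set Ω)) := fun t =>
    Finset.measurableSet_biUnion t fun A _ => (hP A A.2).1
  have hcongr : ∀ {s t : Set Ω} (hs : MeasurableSet s) (ht : MeasurableSet t) (hμs : μ s ≠ ∞)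
      (hμt : μ t ≠ ∞), s = t →
      φ (indicatorConstLp 1 hs hμs 1) = φ (indicatorConstLp 1 ht hμt 1) := by
    rintro s _ _ _ _ _ rfl
    rfl
  have hdrop : ∀ (s : Set Ω) (hs : MeasurableSet s) (hμs : μ s ≠ ∞) (t : Finset P),
      φ (indicatorConstLp 1 hs hμs 1) = φ (indicatorConstLp 1 (hs.diff (hU t))
        (measure_ne_top_of_subset Set.sdiff_subset hμs) 1) := by
    classical
    intro s hs hμs t
    induction t using Finset.induction_on with
    | empty => exact hcongr _ _ _ _ (by simp)
    | insert A t _ ih =>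
      rw [ih]
      set r := s \ ⋃ A ∈ t, (A : Set Ω) with hr
      have hrm : MeasurableSet r := hs.diff (hU t)
      have hμr : μ r ≠ ∞ := measure_ne_top_of_subset Set.sdiff_subset hμs
      have hA := (hP A A.2).1
      have h1 := indicatorConstLp_disjoint_union (p := 1) (hrm.inter hA) (hrm.diff hA)
        (measure_ne_top_of_subset Set.inter_subset_left hμr)
        (measure_ne_top_of_subset Set.sdiff_subset hμr)
        (Set.disjoint_left.2 fun x hx hx' => hx'.2 hx.2) (1 : 𝕜)
      have h2 : φ (indicatorConstLp 1 hrm hμr 1) = φ (indicatorConstLp 1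
          ((hrm.inter hA).union (hrm.diff hA))
          (by rw [Set.inter_union_sdiff]; exact hμr) 1) :=
        hcongr _ _ _ _ (Set.inter_union_sdiff r A).symm
      rw [h2, h1, map_add, h A A.2 _ _ _ Set.inter_subset_right, zero_add]
      refine hcongr _ _ _ _ ?_
      rw [hr, Set.sdiff_sdiff, Finset.set_biUnion_insert, Set.union_comm]
  have hind : ∀ (s : Set Ω) (hs : MeasurableSet s) (hμs : μ s ≠ ∞),
      φ (indicatorConstLp 1 hs hμs 1) = 0 := by
    intro s hs hμs
    -- Outside finitely many pieces, `s` has measure at most the tail of a convergent series, and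
    -- there `φ` is bounded by `‖φ‖` times this measure.
    have hsum : ∑' A : P, μ (s ∩ A) ≠ ∞ := by rwa [← hPs s hs]
    have htend := ENNReal.tendsto_tsum_compl_atTop_zero hsum
    have hle : ∀ t : Finset P, μ (s \ ⋃ A ∈ t, (A : Set Ω)) ≤
        ∑' A : {A : P // A ∉ t}, μ (s ∩ A) := by
      intro t
      rw [hPs _ (hs.diff (hU t))]
      refine le_trans (ENNReal.tsum_le_tsum fun A => ?_)
        (tsum_subtype {A : P | A ∉ t} fun A : P => μ (s ∩ A)).ge
      by_cases hA : A ∈ t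
      · have : (s \ ⋃ A ∈ t, (A : Set Ω)) ∩ A = ∅ := by
          refine Set.eq_empty_of_forall_notMem fun x hx => hx.1.2 ?_
          exact Set.mem_biUnion hA hx.2
        rw [this, measure_empty]
        exact zero_le
      · rw [Set.indicator_of_mem (show A ∈ {A : P | A ∉ t} from hA)]
        exact measure_mono (Set.inter_subset_inter_left _ Set.sdiff_subset)
    have h0 : Tendsto (fun t : Finset P => μ (s \ ⋃ A ∈ t, (A : Set Ω))) atTop (𝓝 0) :=
      tendsto_of_tendsto_of_tendsto_of_le_of_le tendsto_const_nhds htend (fun _ => zero_le) hle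
    have h1 : Tendsto (fun t : Finset P => ‖φ‖ * μ.real (s \ ⋃ A ∈ t, (A : Set Ω))) atTop
        (𝓝 (‖φ‖ * 0)) :=
      ((ENNReal.tendsto_toReal ENNReal.zero_ne_top).comp h0).const_mul _
    rw [mul_zero] at h1
    refine norm_le_zero_iff.1 (ge_of_tendsto' h1 fun t => ?_)
    rw [hdrop s hs hμs t]
    exact norm_apply_indicatorConstLp_le φ _ _
  ext f
  refine Lp.induction ENNReal.one_ne_top (motive := fun f => φ f = 0) ?_ ?_
    (isClosed_eq φ.continuous continuous_const) f
  · intro c s hs hμs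
    have : (Lp.simpleFunc.indicatorConst 1 hs hμs.ne c : Lp 𝕜 1 μ) =
        c • indicatorConstLp 1 hs hμs.ne (1 : 𝕜) := by
      rw [Lp.simpleFunc.coe_indicatorConst]
      refine Lp.ext ?_
      filter_upwards [Lp.coeFn_smul c (indicatorConstLp 1 hs hμs.ne (1 : 𝕜)),
        indicatorConstLp_coeFn (p := 1) (hs := hs) (hμs := hμs.ne) (c := (1 : 𝕜)),
        indicatorConstLp_coeFn (p := 1) (hs := hs) (hμs := hμs.ne) (c := c)] with ω h1 h2 h3
      rw [h1, Pi.smul_apply, h2, h3]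
      by_cases hω : ω ∈ s <;> simp [hω]
    rw [this, map_smul, hind s hs hμs.ne, smul_zero]
  · intro f g hf hg _ h1 h2
    rw [map_add, h1, h2, add_zero]

/-! ### The operator `T_k`: boundedness, norm and surjectivity. -/

namespace PreLinftySigmaStar

variable {𝕜 F Ω : Type*} [RCLike 𝕜] [NormedAddCommGroup F] [NormedSpace 𝕜 F]
  [MeasurableSpace Ω] {μ : Measure Ω}

theorem measurable_apply (k : PreLinftySigmaStar 𝕜 F μ) (v : F) : Measurable fun ω => k ω v :=
  k.2.1 v

theorem ae_norm_apply_le (k : PreLinftySigmaStar 𝕜 F μ) (v : F) :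
    ∀ᵐ ω ∂μ, ‖k ω v‖ ≤ ‖k‖ * ‖v‖ := by
  have hball : ∀ w : F, ‖w‖ ≤ 1 → ∀ᵐ ω ∂μ, ‖k ω w‖ ≤ ‖k‖ := by
    intro w hw
    have hle : essSup (fun ω => ‖k ω w‖ₑ) μ ≤ sigmaStarSup μ k :=
      le_iSup (fun v : Metric.closedBall (0 : F) 1 => essSup (fun ω => ‖k ω (v : F)‖ₑ) μ)
        ⟨w, mem_closedBall_zero_iff.2 hw⟩
    filter_upwards [ENNReal.ae_le_essSup (μ := μ) fun ω => ‖k ω w‖ₑ] with ω hω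
    rw [norm_def, ← toReal_enorm]
    exact ENNReal.toReal_mono k.2.2.ne (hω.trans hle)
  rcases eq_or_ne v 0 with rfl | hv
  · simp
  have hv0 : 0 < ‖v‖ := norm_pos_iff.2 hv
  have hw : ‖((‖v‖⁻¹ : ℝ) : 𝕜) • v‖ ≤ 1 := by
    rw [norm_smul, RCLike.norm_ofReal, abs_of_pos (inv_pos.2 hv0), inv_mul_cancel₀ hv0.ne']
  filter_upwards [hball _ hw] with ω hω
  rw [map_smul, norm_smul, RCLike.norm_ofReal, abs_of_pos (inv_pos.2 hv0)] at hω
  rwa [inv_mul_le_iff₀ hv0, mul_comm] at hω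

theorem sigmaStarSup_le_ofReal {k : Ω → StrongDual 𝕜 F} {C : ℝ}
    (h : ∀ v : F, ‖v‖ ≤ 1 → ∀ᵐ ω ∂μ, ‖k ω v‖ ≤ C) : sigmaStarSup μ k ≤ ENNReal.ofReal C := by
  refine iSup_le fun v => essSup_le_of_ae_le _ ?_
  filter_upwards [h v (mem_closedBall_zero_iff.1 v.2)] with ω hω
  rw [← ofReal_norm]
  exact ENNReal.ofReal_le_ofReal hω

theorem norm_le_of_ae_norm_apply_le (k : PreLinftySigmaStar 𝕜 F μ) {C : ℝ} (hC : 0 ≤ C)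
    (h : ∀ v : F, ‖v‖ ≤ 1 → ∀ᵐ ω ∂μ, ‖k ω v‖ ≤ C) : ‖k‖ ≤ C :=
  ENNReal.toReal_le_of_le_ofReal hC (sigmaStarSup_le_ofReal h)

theorem integrable_apply_mul (k : PreLinftySigmaStar 𝕜 F μ) {f : Ω → 𝕜} (hf : Integrable f μ)
    (v : F) : Integrable (fun ω => k ω v * f ω) μ :=
  hf.bdd_mul (k.measurable_apply v).aestronglyMeasurable (k.ae_norm_apply_le v)

/-- The operator `T_k`. -/
noncomputable def integralOperator (k : PreLinftySigmaStar 𝕜 F μ) :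
    Lp 𝕜 1 μ →L[𝕜] StrongDual 𝕜 F :=
  LinearMap.mkContinuous₂
    (LinearMap.mk₂ 𝕜 (fun (f : Lp 𝕜 1 μ) (v : F) => ∫ ω, k ω v * f ω ∂μ)
      (fun f g v => by
        rw [← integral_add (k.integrable_apply_mul (L1.integrable_coeFn f) v)
          (k.integrable_apply_mul (L1.integrable_coeFn g) v)]
        refine integral_congr_ae ?_
        filter_upwards [Lp.coeFn_add f g] with ω hω
        rw [hω, Pi.add_apply, mul_add])
      (fun c f v => by
        rw [smul_eq_mul, ← integral_const_mul]
        refine integral_congr_ae ?_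
        filter_upwards [Lp.coeFn_smul c f] with ω hω
        rw [hω, Pi.smul_apply, smul_eq_mul, mul_left_comm])
      (fun f v w => by
        rw [← integral_add (k.integrable_apply_mul (L1.integrable_coeFn f) v)
          (k.integrable_apply_mul (L1.integrable_coeFn f) w)]
        simp_rw [map_add, add_mul])
      (fun c f v => by
        rw [smul_eq_mul, ← integral_const_mul]
        simp_rw [map_smul, smul_eq_mul, mul_assoc]))
    ‖k‖ (fun f v => by
      rw [L1.norm_eq_integral_norm, mul_right_comm, ← integral_const_mul]
      refine norm_integral_le_of_norm_le ((L1.integrable_coeFn f).norm.const_mul _) ?_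
      filter_upwards [k.ae_norm_apply_le v] with ω hω
      rw [norm_mul]
      gcongr)

theorem integralOperator_apply (k : PreLinftySigmaStar 𝕜 F μ) (f : Lp 𝕜 1 μ) (v : F) :
    k.integralOperator f v = ∫ ω, k ω v * f ω ∂μ := rfl

theorem norm_integralOperator_le (k : PreLinftySigmaStar 𝕜 F μ) : ‖k.integralOperator‖ ≤ ‖k‖ :=
  LinearMap.mkContinuous₂_norm_le _ (norm_nonneg k) _

theorem integralOperator_indicatorConstLp (k : PreLinftySigmaStar 𝕜 F μ) {E : Set Ω}
    (hE : MeasurableSet E) (hμE : μ E ≠ ∞) (v : F) :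
    k.integralOperator (indicatorConstLp 1 hE hμE 1) v = ∫ ω in E, k ω v ∂μ := by
  rw [integralOperator_apply, ← integral_indicator hE]
  refine integral_congr_ae ?_
  filter_upwards [indicatorConstLp_coeFn (p := 1) (hs := hE) (hμs := hμE) (c := (1 : 𝕜))]
    with ω hω
  rw [hω]
  by_cases h : ω ∈ E <;> simp [h]

theorem norm_integralOperator [μ.IsComplete] (hμ : IsStrictlyLocalizable μ)
    (k : PreLinftySigmaStar 𝕜 F μ) : ‖k.integralOperator‖ = ‖k‖ := by
  obtain ⟨P, -, -, hP, hPm, hPs⟩ := hμ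
  refine le_antisymm k.norm_integralOperator_le
    (k.norm_le_of_ae_norm_apply_le (norm_nonneg k.integralOperator) fun v hv => ?_)
  refine ae_of_forall_ae_restrict hP hPm hPs fun A hA => ?_
  have hμA : μ A ≠ ∞ := (hP A hA).2.ne
  have : IsFiniteMeasure (μ.restrict A) := isFiniteMeasure_restrict.2 hμA
  refine ae_restrict_norm_le_of_forall_setIntegral (hP A hA).1 hμA
    (Integrable.of_bound (k.measurable_apply v).aestronglyMeasurable _
      (ae_restrict_of_ae (k.ae_norm_apply_le v))) fun E hE hEA => ?_
  have hμE : μ E ≠ ∞ := measure_ne_top_of_subset hEA hμA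
  rw [← k.integralOperator_indicatorConstLp hE hμE]
  calc ‖k.integralOperator (indicatorConstLp 1 hE hμE 1) v‖
      ≤ ‖k.integralOperator (indicatorConstLp 1 hE hμE 1)‖ * ‖v‖ :=
        ContinuousLinearMap.le_opNorm _ _
    _ ≤ ‖k.integralOperator (indicatorConstLp 1 hE hμE 1)‖ :=
        mul_le_of_le_one_right (norm_nonneg _) hv
    _ ≤ ‖k.integralOperator‖ * μ.real E := norm_apply_indicatorConstLp_le _ hE hμE

/-- Local densities are glued along the partition; their common pointwise bound `‖T‖` keeps the
result in the space. -/
theorem integralOperator_surjective [μ.IsComplete] (hμ : IsStrictlyLocalizable μ) :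
    Function.Surjective (integralOperator : PreLinftySigmaStar 𝕜 F μ → _) := by
  intro T
  obtain ⟨P, hPd, hPu, hP, hPm, hPs⟩ := hμ
  choose! κ hκb hκm hκ using fun (A : Set Ω) (hA : A ∈ P) =>
    exists_local_density (hP A hA).1 (hP A hA).2.ne T
  choose π hπP hπ using fun ω : Ω => Set.mem_sUnion.1 (hPu ▸ Set.mem_univ ω : ω ∈ ⋃₀ P)
  have hπA : ∀ A ∈ P, ∀ ω ∈ A, π ω = A := fun A hA ω hω =>
    hPd.elim (hπP ω) hA (Set.not_disjoint_iff.2 ⟨ω, hπ ω, hω⟩)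
  let k₀ : Ω → StrongDual 𝕜 F := fun ω => κ (π ω) ω
  have hmeas : ∀ v, Measurable fun ω => k₀ ω v := by
    intro v S hS
    refine hPm _ fun A hA => ?_
    have h1 : (fun ω => k₀ ω v) ⁻¹' S ∩ A = (fun ω => κ A ω v) ⁻¹' S ∩ A := by
      ext ω
      simp only [Set.mem_inter_iff, Set.mem_preimage, and_congr_left_iff, k₀]
      intro hω
      rw [hπA A hA ω hω]
    rw [h1]
    -- On `A` the density is only a.e. measurable; completeness upgrades its preimages to measurable
    -- sets.
    have h2 : NullMeasurableSet ((fun ω => κ A ω v) ⁻¹' S) (μ.restrict A) :=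
      (hκm A hA v).nullMeasurable hS
    exact ((nullMeasurableSet_restrict (hP A hA).1.nullMeasurableSet).1 h2).measurable_of_complete
  have hbound : sigmaStarSup μ k₀ < ∞ := by
    refine (sigmaStarSup_le_ofReal (C := ‖T‖) fun v hv => ae_of_all _ fun ω => ?_).trans_lt
      ENNReal.ofReal_lt_top
    exact ((κ (π ω) ω).le_of_opNorm_le_of_le (hκb _ (hπP ω) ω) hv).trans_eq (mul_one _)
  let k : PreLinftySigmaStar 𝕜 F μ := ⟨k₀, hmeas, hbound⟩
  refine ⟨k, ?_⟩
  ext f v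
  -- For fixed `v` the difference is a scalar functional on `L¹`, so checking subsets of single
  -- pieces is enough.
  have h0 : (k.integralOperator - T).flip v = 0 := by
    refine eq_zero_of_forall_indicatorConstLp hP hPs _ fun A hA E hE hμE hEA => ?_
    rw [ContinuousLinearMap.flip_apply, sub_apply,
      sub_apply, sub_eq_zero, integralOperator_indicatorConstLp,
      hκ A hA E hE hμE hEA v]
    refine setIntegral_congr_fun hE fun ω hω => ?_
    change κ (π ω) ω v = κ A ω v
    rw [hπA A hA ω (hEA hω)]
  have h1 := DFunLike.congr_fun h0 f
  rw [ContinuousLinearMap.flip_apply, sub_apply,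
    sub_apply] at h1
  exact sub_eq_zero.1 h1

/-- `k ↦ T_k` as a continuous linear map. -/
noncomputable def integralOperatorL :
    PreLinftySigmaStar 𝕜 F μ →L[𝕜] Lp 𝕜 1 μ →L[𝕜] StrongDual 𝕜 F :=
  LinearMap.mkContinuous
    { toFun := fun k : PreLinftySigmaStar 𝕜 F μ => k.integralOperator
      map_add' := fun k l => by
        ext f v
        change ∫ ω, (k ω v + l ω v) * f ω ∂μ = ∫ ω, k ω v * f ω ∂μ + ∫ ω, l ω v * f ω ∂μ
        rw [← integral_add (k.integrable_apply_mul (L1.integrable_coeFn f) v)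
          (l.integrable_apply_mul (L1.integrable_coeFn f) v)]
        simp_rw [add_mul]
      map_smul' := fun c k => by
        ext f v
        change ∫ ω, c * k ω v * f ω ∂μ = c * ∫ ω, k ω v * f ω ∂μ
        rw [← integral_const_mul]
        simp_rw [mul_assoc] }
    1 fun k => by
      rw [one_mul]
      exact k.norm_integralOperator_le

end PreLinftySigmaStar

/-! ### Descent to the quotient and the isometric isomorphism. -/

open PreLinftySigmaStar in
theorem mainTheorem2 {𝕜 F Ω : Type*} [RCLike 𝕜]
    [NormedAddCommGroup F] [NormedSpace 𝕜 F] [CompleteSpace F]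
    [MeasurableSpace Ω] (μ : Measure Ω) [μ.IsComplete] (hμ : IsStrictlyLocalizable μ) :
    ∃ Φ : LinftySigmaStar 𝕜 F μ ≃ₗᵢ[𝕜] (Lp 𝕜 1 μ →L[𝕜] StrongDual 𝕜 F),
      ∀ (k : PreLinftySigmaStar 𝕜 F μ) (f : Lp 𝕜 1 μ) (v : F),
        Integrable (fun ω => k ω v * f ω) μ ∧
        Φ (SeparationQuotient.mk k) f v = ∫ ω, k ω v * f ω ∂μ := by
  let I : PreLinftySigmaStar 𝕜 F μ →L[𝕜] _ := integralOperatorL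
  let L : LinftySigmaStar 𝕜 F μ →L[𝕜] (Lp 𝕜 1 μ →L[𝕜] StrongDual 𝕜 F) :=
    SeparationQuotient.liftCLM I fun x y h => (h.map I.continuous).eq
  have hL : ∀ x, ‖L x‖ = ‖x‖ := fun x => by
    obtain ⟨k, rfl⟩ := SeparationQuotient.surjective_mk x
    rw [SeparationQuotient.norm_mk]
    exact norm_integralOperator hμ k
  let Φ : LinftySigmaStar 𝕜 F μ →ₗᵢ[𝕜] (Lp 𝕜 1 μ →L[𝕜] StrongDual 𝕜 F) := ⟨L.toLinearMap, hL⟩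
  have hsurj : Function.Surjective Φ := fun T => by
    obtain ⟨k, rfl⟩ := integralOperator_surjective hμ T
    exact ⟨SeparationQuotient.mk k, rfl⟩
  exact ⟨LinearIsometryEquiv.ofSurjective Φ hsurj, fun k f v =>
    ⟨k.integrable_apply_mul (L1.integrable_coeFn f) v, rfl⟩⟩
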